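/- For integers $n\ge 0$ and $k\ge 0$ let the Mahonian number $M_{n,k}$ be the number of permutations of $\{1,\dots,n\}$ with exactly $k$ inversions; equivalently, the number of integer solutions of $\eta_1+\dots+\eta_n=k$ with $0\le\eta_j<j$. For $\nu\ge n$ let the generalised Mahonian number $M^{\nu,\varkappa}_{n,k}$ be the number of integer solutions of $\eta_{n+1}+\dots+\eta_\nu=\varkappa-k$ with $0\le\eta_j<j$. For $q\in[0,\infty)$ put $[j]_q=1+q+\dots+q^{j-1}$ and $[n]_q!=\prod_{j=1}^n[j]_q$; for $q=\infty$ and $0\le k\le\binom n2$ the expression $q^k/[n]_q!$ is understood as its limit, which is $1$ if $k=\binom n2$ and $0$ otherwise. Let $\varkappa(\nu)$, $\nu=0,1,2,\dots$, be nonnegative integers with $\varkappa(\nu)\le\binom\nu2$ for all sufficiently large $\nu$. (i) If the ratios $M^{\nu,\varkappa(\nu)}_{n,k}/M_{\nu,\varkappa(\nu)}$ converge as $\nu\to\infty$ for all $n\ge1$ and $0\le k\le\binom n2$, then there is $q\in[0,\infty]$ such that the limit is $q^k/[n]_q!$ for all these $n,k$. (ii) The ratios converge for all $n\ge1$ and $0\le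 k\le\binom n2$ if and only if one of the following holds: (a) $\lim_{\nu\to\infty}\varkappa(\nu)/\nu=\frac{q}{1-q}$ for some $0\le q<1$; (b) $\lim_{\nu\to\infty}\bigl(\binom\nu2-\varkappa(\nu)\bigr)/\nu=\frac{q^{-1}}{1-q^{-1}}$ for some $1<q\le\infty$ (with $\infty^{-1}=0$); (c) $\varkappa(\nu)/\nu\to\infty$ and $\bigl(\binom\nu2-\varkappa(\nu)\bigr)/\nu\to\infty$. (iii) More precisely, for each $q\in[0,\infty]$ the ratios converge to $q^k/[n]_q!$ for all $n\ge1$ and $0\le k\le\binom n2$ if and only if (a) holds with this $q$ (when $q<1$), (b) holds with this $q$ (when $q>1$), (c) holds (when $q=1$). -/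

import Mathlib

open Filter Topology
open scoped ENNReal

/-- The number of inversions of a permutation `π`: pairs of positions `i < j` with
`π i > π j`. -/
def inversions {n : ℕ} (π : Equiv.Perm (Fin n)) : ℕ :=
  (Finset.univ.filter fun p : Fin n × Fin n => p.1 < p.2 ∧ π p.2 < π p.1).card

/-- The Mahonian number `M_{n,k}`: the number of permutations of `n` letters that have exactly `k`
inversions. -/
def mahonian (n k : ℕ) : ℕ :=
  (Finset.univ.filter fun π : Equiv.Perm (Fin n) => inversions π = k).card

/-- The generalised Mahonian number `M_{n,k}^{ν,κ}`: the number of integer solutions of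
`η_{n+1} + ⋯ + η_ν = κ - k` with `0 ≤ η_j < j`. The equation is written without subtraction, so
that there is no solution when `κ < k`. -/
def genMahonian (n k ν κ : ℕ) : ℕ :=
  Fintype.card
    {η : (j : ↥(Finset.Ioc n ν)) → Fin (j : ℕ) // k + ∑ j : ↥(Finset.Ioc n ν), (η j : ℕ) = κ}

/-- The ratio `M_{n,k}^{ν,κ} / M_{ν,κ}`. -/
noncomputable def mahonianRatio (n k ν κ : ℕ) : ℝ :=
  (genMahonian n k ν κ : ℝ) / (mahonian ν κ : ℝ)

/-- The `q`-factorial `[n]_q! = ∏_{j=1}^n [j]_q`, where `[j]_q = 1 + q + ⋯ + q^{j-1}`, that is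
`(1 - q^j) / (1 - q)` for `q ≠ 1`. -/
noncomputable def qFactorial (q : ℝ) (n : ℕ) : ℝ :=
  ∏ j ∈ Finset.Icc 1 n, ∑ i ∈ Finset.range j, q ^ i

/-- The Mallows mass `q^k / [n]_q!` of a permutation of `n` letters with `k` inversions, for
`q ∈ [0, ∞]`. For `q = ∞` the Mallows distribution is concentrated on the decreasing permutation,
the only one with `n.choose 2` inversions. -/
noncomputable def mallowsMass (q : ℝ≥0∞) (n k : ℕ) : ℝ :=
  if q = ∞ then (if k = n.choose 2 then 1 else 0) else q.toReal ^ k / qFactorial q.toReal n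

/-- The ratios `M_{n,k}^{ν,κ(ν)} / M_{ν,κ(ν)}` tend to `L n k` as `ν → ∞`, for all `n ≥ 1` and
`0 ≤ k ≤ n.choose 2`. -/
def RatiosTendTo (κ : ℕ → ℕ) (L : ℕ → ℕ → ℝ) : Prop :=
  ∀ n k : ℕ, 1 ≤ n → k ≤ n.choose 2 →
    Tendsto (fun ν : ℕ => mahonianRatio n k ν (κ ν)) atTop (𝓝 (L n k))

/-- `κ(ν) ∼ (q / (1 - q)) ν`, as convergence of the quotient by `ν` (for `q = 0` it reads
`κ(ν) = o(ν)`). Meant for `0 ≤ q < 1`. -/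
def LowRegime (κ : ℕ → ℕ) (q : ℝ≥0∞) : Prop :=
  Tendsto (fun ν : ℕ => (κ ν : ℝ) / (ν : ℝ)) atTop (𝓝 (q.toReal / (1 - q.toReal)))

/-- `ν.choose 2 - κ(ν) ∼ (q⁻¹ / (1 - q⁻¹)) ν`, as convergence of the quotient by `ν`, with
`∞⁻¹ = 0` (for `q = ∞` it reads `ν.choose 2 - κ(ν) = o(ν)`). Meant for `1 < q ≤ ∞`. -/
def HighRegime (κ : ℕ → ℕ) (q : ℝ≥0∞) : Prop :=
  Tendsto (fun ν : ℕ => ((ν.choose 2 : ℝ) - (κ ν : ℝ)) / (ν : ℝ)) atTop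
    (𝓝 ((q⁻¹).toReal / (1 - (q⁻¹).toReal)))

/-- Both `κ(ν)` and `ν.choose 2 - κ(ν)` grow faster than linearly. -/
def SuperlinearRegime (κ : ℕ → ℕ) : Prop :=
  Tendsto (fun ν : ℕ => (κ ν : ℝ) / (ν : ℝ)) atTop atTop ∧
    Tendsto (fun ν : ℕ => ((ν.choose 2 : ℝ) - (κ ν : ℝ)) / (ν : ℝ)) atTop atTop

section BoxPolynomials

open Polynomial

/-- The `q`-number `[j]` as a polynomial in `q`. -/
noncomputable def qNumber (j : ℕ) : ℝ[X] := ∑ i ∈ Finset.range j, X ^ i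

/-- The product of the `q`-numbers `[j]` over `j ∈ s`, as a polynomial in `q`. -/
noncomputable def qProduct (s : Finset ℕ) : ℝ[X] := ∏ j ∈ s, qNumber j

lemma qNumber_coeff (j i : ℕ) : (qNumber j).coeff i = if i < j then 1 else 0 := by
  simp [qNumber, coeff_X_pow]

lemma qProduct_coeff_nonneg (s : Finset ℕ) (m : ℕ) : 0 ≤ (qProduct s).coeff m := by
  induction s using Finset.induction_on generalizing m with
  | empty => simp only [qProduct, Finset.prod_empty, coeff_one]; split_ifs <;> simp
  | insert j s hj ih =>
    rw [qProduct, Finset.prod_insert hj, coeff_mul]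
    refine Finset.sum_nonneg fun p _ => mul_nonneg ?_ (ih _)
    rw [qNumber_coeff]; split_ifs <;> simp

lemma qProduct_eq_mul_erase {s : Finset ℕ} {j : ℕ} (hj : j ∈ s) :
    qProduct s = qNumber j * qProduct (s.erase j) :=
  (Finset.mul_prod_erase s qNumber hj).symm

lemma qProduct_erase_coeff_le {s : Finset ℕ} {j : ℕ} (hj : j ∈ s) (hj0 : 0 < j) (m : ℕ) :
    (qProduct (s.erase j)).coeff m ≤ (qProduct s).coeff m := by
  rw [qProduct_eq_mul_erase hj, coeff_mul]
  have h0 : (qNumber j).coeff 0 * (qProduct (s.erase j)).coeff m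
      = (qProduct (s.erase j)).coeff m := by simp [qNumber_coeff, hj0]
  rw [← h0]
  refine Finset.single_le_sum
    (f := fun p : ℕ × ℕ => (qNumber j).coeff p.1 * (qProduct (s.erase j)).coeff p.2)
    (fun p _ => mul_nonneg ?_ (qProduct_coeff_nonneg _ _)) (a := (0, m)) (by simp)
  rw [qNumber_coeff]; split_ifs <;> simp

lemma one_sub_X_mul_derivative_qNumber (j : ℕ) :
    (1 - X) * derivative (qNumber j) = qNumber j - C (j : ℝ) * X ^ (j - 1) := by
  have h : (1 - X) * qNumber j = 1 - X ^ j := by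
    rw [qNumber, mul_comm]; exact geom_sum_mul_neg X j
  have h' := congrArg derivative h
  simp only [derivative_mul, derivative_sub, derivative_one, derivative_X, derivative_X_pow] at h'
  linear_combination h'

lemma one_sub_X_mul_derivative_qProduct (s : Finset ℕ) :
    (1 - X) * derivative (qProduct s) = C (s.card : ℝ) * qProduct s
      - ∑ j ∈ s, C (j : ℝ) * (qProduct (s.erase j) * X ^ (j - 1)) := by
  have h : ∀ j ∈ s, (1 - X) * ((∏ i ∈ s.erase j, qNumber i) * derivative (qNumber j))
      = qProduct s - C (j : ℝ) * (qProduct (s.erase j) * X ^ (j - 1)) := by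
    intro j hj
    rw [qProduct_eq_mul_erase hj, mul_left_comm, one_sub_X_mul_derivative_qNumber, ← qProduct]
    ring
  rw [qProduct, derivative_prod_finset, Finset.mul_sum, Finset.sum_congr rfl h, Finset.sum_sub_distrib]
  simp [qProduct]

lemma qProduct_coeff_recursion (s : Finset ℕ) (m : ℕ) :
    (m + 1 : ℝ) * (qProduct s).coeff (m + 1) = (s.card + m : ℝ) * (qProduct s).coeff m
      - ∑ j ∈ s, (j : ℝ) * (qProduct (s.erase j) * X ^ (j - 1)).coeff m := by
  have h := congrArg (fun p => coeff p m) (one_sub_X_mul_derivative_qProduct s)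
  simp only [sub_mul, one_mul, coeff_sub, coeff_C_mul, finsetSum_coeff, coeff_derivative] at h
  have h2 : (X * derivative (qProduct s)).coeff m = m * (qProduct s).coeff m := by
    cases m with
    | zero => simp
    | succ m => rw [coeff_X_mul, coeff_derivative]; push_cast; ring
  rw [h2] at h
  linarith

lemma succ_mul_qProduct_coeff_succ_le (s : Finset ℕ) (m : ℕ) :
    (m + 1 : ℝ) * (qProduct s).coeff (m + 1) ≤ (s.card + m : ℝ) * (qProduct s).coeff m := by
  rw [qProduct_coeff_recursion, sub_le_self_iff]
  refine Finset.sum_nonneg fun j _ => mul_nonneg (Nat.cast_nonneg _) ?_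
  rw [coeff_mul_X_pow']
  split_ifs
  exacts [qProduct_coeff_nonneg _ _, le_rfl]

/-- As long as `m` is at most about `ρ / (1 - ρ)` times the number of factors, the coefficients
of `qProduct s` grow at least geometrically, with ratio `ρ⁻¹`, up to the one of index `m + 1`. -/
lemma qProduct_coeff_le_mul_succ {s : Finset ℕ} (hs : ∀ j ∈ s, 0 < j) {ρ : ℝ} (hρ0 : 0 < ρ)
    (hρ1 : ρ < 1) {c : ℝ} (hc : ∑ j ∈ s, (j : ℝ) * ρ ^ (j - 1) ≤ c) (m : ℕ)
    (hm : (m + 1 : ℝ) ≤ ρ * (s.card + m - c)) :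
    (qProduct s).coeff m ≤ ρ * (qProduct s).coeff (m + 1) := by
  induction m using Nat.strong_induction_on with
  | _ m ih =>
    have hpow : ∀ i ≤ m, (qProduct s).coeff (m - i) ≤ ρ ^ i * (qProduct s).coeff m := by
      intro i hi
      induction i with
      | zero => simp
      | succ i ihi =>
        have hcast : ((m - (i + 1) : ℕ) : ℝ) = m - (i + 1) := by
          rw [Nat.cast_sub hi]; push_cast; ring
        have h1 := ih (m - (i + 1)) (by omega) (by
          rw [hcast]
          have hi0 : (0 : ℝ) ≤ i := Nat.cast_nonneg i
          nlinarith)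
        rw [show m - (i + 1) + 1 = m - i by omega] at h1
        calc _ ≤ _ := h1
          _ ≤ ρ * (ρ ^ i * (qProduct s).coeff m) := by gcongr; exact ihi (by omega)
          _ = _ := by ring
    have ha := qProduct_coeff_nonneg s m
    have hE : ∑ j ∈ s, (j : ℝ) * (qProduct (s.erase j) * X ^ (j - 1)).coeff m
        ≤ c * (qProduct s).coeff m := by
      refine le_trans ?_ (mul_le_mul_of_nonneg_right hc ha)
      rw [Finset.sum_mul]
      refine Finset.sum_le_sum fun j hj => ?_
      rw [mul_assoc]
      refine mul_le_mul_of_nonneg_left ?_ (Nat.cast_nonneg _)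
      rw [coeff_mul_X_pow']
      split_ifs with hjm
      · exact (qProduct_erase_coeff_le hj (hs j hj) _).trans (hpow _ hjm)
      · positivity
    have hrec := qProduct_coeff_recursion s m
    have hm0 : (0 : ℝ) < m + 1 := by positivity
    have h1 : (s.card + m - c) * (qProduct s).coeff m ≤ (m + 1) * (qProduct s).coeff (m + 1) := by
      rw [hrec]; linarith
    have h2 := mul_le_mul_of_nonneg_right hm ha
    have h3 := mul_le_mul_of_nonneg_left h1 hρ0.le
    have h4 : (m + 1 : ℝ) * (qProduct s).coeff m
        ≤ (m + 1) * (ρ * (qProduct s).coeff (m + 1)) := by linarith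
    exact le_of_mul_le_mul_left h4 hm0

lemma qProduct_Icc_succ (n : ℕ) :
    qProduct (Finset.Icc 1 (n + 1)) = qNumber (n + 1) * qProduct (Finset.Icc 1 n) := by
  rw [qProduct, Finset.prod_Icc_succ_top (by omega), mul_comm, qProduct]

lemma qProduct_Icc_coeff_pos (n k : ℕ) (hk : k ≤ n.choose 2) :
    0 < (qProduct (Finset.Icc 1 n)).coeff k := by
  induction n generalizing k with
  | zero =>
    obtain rfl : k = 0 := by simpa using hk
    simp [qProduct]
  | succ n ih =>
    rw [qProduct_Icc_succ, coeff_mul]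
    rw [Nat.choose_succ_succ' n 1, one_add_one_eq_two, Nat.choose_one_right] at hk
    refine Finset.sum_pos' (fun p _ => mul_nonneg ?_ (qProduct_coeff_nonneg _ _))
      ⟨(k - min k (n.choose 2), min k (n.choose 2)), by simp, ?_⟩
    · rw [qNumber_coeff]; split_ifs <;> simp
    · rw [qNumber_coeff, if_pos (by dsimp only; omega), one_mul]
      exact ih _ (min_le_right _ _)

lemma qProduct_Icc_natDegree_le (n : ℕ) :
    (qProduct (Finset.Icc 1 n)).natDegree ≤ n.choose 2 := by
  induction n with
  | zero => simp [qProduct]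
  | succ n ih =>
    rw [qProduct_Icc_succ, Nat.choose_succ_succ' n 1, one_add_one_eq_two, Nat.choose_one_right]
    refine natDegree_mul_le.trans (add_le_add ?_ ih)
    rw [natDegree_le_iff_coeff_eq_zero]
    intro N hN
    rw [qNumber_coeff, if_neg (by omega)]

lemma qProduct_Icc_eval (q : ℝ) (n : ℕ) :
    (qProduct (Finset.Icc 1 n)).eval q = qFactorial q n := by
  simp [qProduct, qNumber, qFactorial, eval_prod, eval_finsetSum]

end BoxPolynomials

section Counting

open Polynomial

/-- The permutation with first value `p` whose other values are in the same relative order as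
those of `σ`. -/
def permCons {n : ℕ} (p : Fin (n + 1)) (σ : Equiv.Perm (Fin n)) : Equiv.Perm (Fin (n + 1)) :=
  (finSuccEquiv' 0).trans ((Equiv.optionCongr σ).trans (finSuccEquiv' p).symm)

@[simp] lemma permCons_zero {n : ℕ} (p : Fin (n + 1)) (σ : Equiv.Perm (Fin n)) :
    permCons p σ 0 = p := by
  simp [permCons]

@[simp] lemma permCons_succ {n : ℕ} (p : Fin (n + 1)) (σ : Equiv.Perm (Fin n)) (i : Fin n) :
    permCons p σ i.succ = p.succAbove (σ i) := by
  have h : finSuccEquiv' (0 : Fin (n + 1)) i.succ = some i := by simp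
  simp [permCons, h]

lemma permCons_bijective (n : ℕ) :
    Function.Bijective fun x : Fin (n + 1) × Equiv.Perm (Fin n) => permCons x.1 x.2 := by
  rw [Fintype.bijective_iff_injective_and_card]
  refine ⟨?_, by simp [Fintype.card_perm, Nat.factorial_succ]⟩
  rintro ⟨p, σ⟩ ⟨p', σ'⟩ h
  have h0 : p = p' := by simpa using DFunLike.congr_fun h 0
  subst h0
  congr 1
  ext i
  have := DFunLike.congr_fun h i.succ
  simp only [permCons_succ] at this
  rw [Fin.succAbove_right_injective this]

lemma inversions_eq_sum {n : ℕ} (π : Equiv.Perm (Fin n)) :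
    inversions π = ∑ i, ∑ j, if i < j ∧ π j < π i then 1 else 0 := by
  rw [inversions, Finset.card_filter, Fintype.sum_prod_type]

lemma inversions_permCons {n : ℕ} (p : Fin (n + 1)) (σ : Equiv.Perm (Fin n)) :
    inversions (permCons p σ) = p + inversions σ := by
  rw [inversions_eq_sum, inversions_eq_sum, Fin.sum_univ_succ]
  congr 1
  · rw [Fin.sum_univ_succ]
    simp only [lt_self_iff_false, false_and, if_false, zero_add, Fin.succ_pos, true_and,
      permCons_zero, permCons_succ, Fin.succAbove_lt_iff_castSucc_lt]
    rw [Equiv.sum_comp σ (fun i => if i.castSucc < p then 1 else 0)]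
    simp only [Fin.lt_def, Fin.val_castSucc]
    rw [Fin.sum_univ_eq_sum_range (fun i => if i < (p : ℕ) then 1 else 0), ← Finset.card_filter,
      show (Finset.range n).filter (· < (p : ℕ)) = Finset.range p by
        ext i; have := p.isLt; simp; omega, Finset.card_range]
  · refine Finset.sum_congr rfl fun i _ => ?_
    rw [Fin.sum_univ_succ]
    simp [Fin.succAbove_lt_succAbove_iff]

lemma sum_X_pow_inversions (n : ℕ) :
    ∑ π : Equiv.Perm (Fin n), (X : ℝ[X]) ^ inversions π = qProduct (Finset.Icc 1 n) := by
  induction n with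
  | zero => simp [qProduct, inversions]
  | succ n ih =>
    rw [qProduct_Icc_succ, ← ih, ← Equiv.sum_comp (Equiv.ofBijective _ (permCons_bijective n)),
      Fintype.sum_prod_type, qNumber, ← Fin.sum_univ_eq_sum_range (fun i => (X : ℝ[X]) ^ i),
      Finset.sum_mul_sum]
    simp [inversions_permCons, pow_add]

lemma mahonian_eq_coeff (n k : ℕ) :
    (mahonian n k : ℝ) = (qProduct (Finset.Icc 1 n)).coeff k := by
  rw [← sum_X_pow_inversions, finsetSum_coeff, mahonian, Finset.card_filter]
  push_cast
  simp only [coeff_X_pow, eq_comm]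

lemma genMahonian_eq_coeff (n k ν κ : ℕ) :
    (genMahonian n k ν κ : ℝ) = (qProduct (Finset.Ioc n ν) * X ^ k).coeff κ := by
  have h : qProduct (Finset.Ioc n ν)
      = ∑ η : (j : ↥(Finset.Ioc n ν)) → Fin (j : ℕ), X ^ (∑ j, (η j : ℕ)) := by
    rw [qProduct, ← Finset.prod_coe_sort]
    simp only [qNumber, ← Fin.sum_univ_eq_sum_range (fun i => (X : ℝ[X]) ^ i),
      ← Finset.prod_pow_eq_pow_sum]
    exact Finset.prod_univ_sum (fun j => Finset.univ) _ |>.trans (by rw [Fintype.piFinset_univ])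
  rw [h, Finset.sum_mul, finsetSum_coeff, genMahonian, Fintype.card_subtype, Finset.card_filter]
  push_cast
  simp only [← pow_add, coeff_X_pow, eq_comm, add_comm]

lemma genMahonian_eq_of_le {n k ν κ : ℕ} (h : k ≤ κ) :
    (genMahonian n k ν κ : ℝ) = (qProduct (Finset.Ioc n ν)).coeff (κ - k) := by
  rw [genMahonian_eq_coeff, coeff_mul_X_pow', if_pos h]

lemma genMahonian_eq_zero_of_lt {n k ν κ : ℕ} (h : κ < k) : genMahonian n k ν κ = 0 := by
  have : (genMahonian n k ν κ : ℝ) = 0 := by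
    rw [genMahonian_eq_coeff, coeff_mul_X_pow', if_neg (by omega)]
  exact_mod_cast this

lemma mahonian_eq_genMahonian (ν κ : ℕ) : mahonian ν κ = genMahonian 0 0 ν κ := by
  have : (mahonian ν κ : ℝ) = genMahonian 0 0 ν κ := by
    rw [mahonian_eq_coeff, genMahonian_eq_of_le (Nat.zero_le _)]
    rfl
  exact_mod_cast this

lemma mahonian_pos {n k : ℕ} (hk : k ≤ n.choose 2) : 0 < mahonian n k := by
  have := qProduct_Icc_coeff_pos n k hk
  rw [← mahonian_eq_coeff] at this
  exact_mod_cast this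

lemma sum_mahonian_mul_genMahonian {n ν : ℕ} (h : n ≤ ν) (κ : ℕ) :
    ∑ k ∈ Finset.range (n.choose 2 + 1), (mahonian n k : ℝ) * genMahonian n k ν κ
      = mahonian ν κ := by
  have hmul : qProduct (Finset.Icc 1 ν)
      = qProduct (Finset.Icc 1 n) * qProduct (Finset.Ioc n ν) :=
    (Finset.prod_Ioc_consecutive qNumber (Nat.zero_le n) h).symm
  rw [mahonian_eq_coeff, hmul,
    as_sum_range' _ _ (Nat.lt_succ_of_le (qProduct_Icc_natDegree_le n)), Finset.sum_mul,
    finsetSum_coeff]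
  refine Finset.sum_congr rfl fun k _ => ?_
  rw [mahonian_eq_coeff, genMahonian_eq_coeff, ← C_mul_X_pow_eq_monomial, mul_assoc, coeff_C_mul,
    mul_comm (X ^ k)]

lemma sum_mahonian_mul_pow (q : ℝ) (n : ℕ) :
    ∑ k ∈ Finset.range (n.choose 2 + 1), (mahonian n k : ℝ) * q ^ k = qFactorial q n := by
  rw [← qProduct_Icc_eval, eval_eq_sum_range' (Nat.lt_succ_of_le (qProduct_Icc_natDegree_le n))]
  simp only [mahonian_eq_coeff]

lemma sum_pred_Ioc {n ν : ℕ} (h : n ≤ ν) :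
    n.choose 2 + ∑ j ∈ Finset.Ioc n ν, (j - 1) = ν.choose 2 := by
  induction ν, h using Nat.le_induction with
  | base => simp
  | succ ν h ih =>
    rw [Finset.sum_Ioc_succ_top (by omega), ← add_assoc, ih, Nat.choose_succ_succ' ν 1, one_add_one_eq_two,
      Nat.choose_one_right]
    omega

lemma genMahonian_reflect {n k ν κ : ℕ} (h : n ≤ ν) (hk : k ≤ n.choose 2)
    (hκ : κ ≤ ν.choose 2) :
    genMahonian n (n.choose 2 - k) ν (ν.choose 2 - κ) = genMahonian n k ν κ := by
  refine Fintype.card_congr (Equiv.subtypeEquiv (Equiv.piCongrRight fun j => Fin.revPerm) ?_)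
  intro η
  have hsum : ∑ j : ↥(Finset.Ioc n ν), (η j : ℕ) + ∑ j : ↥(Finset.Ioc n ν), ((η j).rev : ℕ)
      = ∑ j ∈ Finset.Ioc n ν, (j - 1) := by
    rw [← Finset.sum_add_distrib, ← Finset.sum_coe_sort (Finset.Ioc n ν) fun j => j - 1]
    refine Finset.sum_congr rfl fun j _ => ?_
    rw [Fin.val_rev]
    have := (η j).isLt
    omega
  have := sum_pred_Ioc h
  simp only [Equiv.piCongrRight_apply, Pi.map_apply, Fin.revPerm_apply]
  omega

lemma mahonianRatio_reflect {n k ν κ : ℕ} (h : n ≤ ν) (hk : k ≤ n.choose 2)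
    (hκ : κ ≤ ν.choose 2) :
    mahonianRatio n (n.choose 2 - k) ν (ν.choose 2 - κ) = mahonianRatio n k ν κ := by
  have h0 := genMahonian_reflect (Nat.zero_le ν) (k := 0) (Nat.zero_le _) hκ
  rw [Nat.sub_zero] at h0
  rw [mahonianRatio, mahonianRatio, genMahonian_reflect h hk hκ, mahonian_eq_genMahonian,
    mahonian_eq_genMahonian ν κ]
  exact congrArg _ (congrArg _ h0)

lemma sub_mul_genMahonian_le {n ν : ℕ} (h : n ≤ ν) (k κ : ℕ) :
    ((κ : ℝ) - k) * genMahonian n k ν κ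
      ≤ ((ν : ℝ) - n + (κ - k) - 1) * genMahonian n (k + 1) ν κ := by
  rcases lt_trichotomy κ k with hk | rfl | hk
  · simp [genMahonian_eq_zero_of_lt hk, genMahonian_eq_zero_of_lt (hk.trans (Nat.lt_succ_self k))]
  · simp [genMahonian_eq_zero_of_lt (Nat.lt_succ_self κ)]
  · obtain ⟨m, rfl⟩ := Nat.exists_eq_add_of_lt hk
    have := succ_mul_qProduct_coeff_succ_le (Finset.Ioc n ν) m
    rw [genMahonian_eq_of_le (by omega), genMahonian_eq_of_le (by omega),
      show k + m + 1 - k = m + 1 by omega, show k + m + 1 - (k + 1) = m by omega]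
    rw [Nat.card_Ioc, Nat.cast_sub h] at this
    push_cast
    convert this using 2 <;> ring

lemma genMahonian_succ_le_mul {ρ : ℝ} (hρ0 : 0 < ρ) (hρ1 : ρ < 1) :
    ∃ c : ℝ, ∀ n ν k κ : ℕ, n ≤ ν → (κ : ℝ) - k ≤ ρ * (ν - n + (κ - k) - 1 - c) →
      (genMahonian n (k + 1) ν κ : ℝ) ≤ ρ * genMahonian n k ν κ := by
  have hsum : Summable fun j : ℕ => (j : ℝ) * ρ ^ (j - 1) := by
    rw [← summable_nat_add_iff 1]
    have h1 := summable_pow_mul_geometric_of_norm_lt_one 1 (r := ρ)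
      (by rwa [Real.norm_of_nonneg hρ0.le])
    have h2 := summable_geometric_of_lt_one hρ0.le hρ1
    refine (h1.add h2).congr fun j => ?_
    simp; ring
  refine ⟨∑' j : ℕ, (j : ℝ) * ρ ^ (j - 1), fun n ν k κ h hm => ?_⟩
  rcases Nat.lt_or_ge κ (k + 1) with hk | hk
  · rw [genMahonian_eq_zero_of_lt hk, Nat.cast_zero]; positivity
  · obtain ⟨m, rfl⟩ := Nat.exists_eq_add_of_le hk
    rw [genMahonian_eq_of_le (by omega), genMahonian_eq_of_le (by omega),
      show k + 1 + m - k = m + 1 by omega, show k + 1 + m - (k + 1) = m by omega]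
    refine qProduct_coeff_le_mul_succ (fun j hj => ?_) hρ0 hρ1
      (hsum.sum_le_tsum _ fun j _ => by positivity) m ?_
    · have := (Finset.mem_Ioc.1 hj).1
      omega
    · rw [Nat.card_Ioc, Nat.cast_sub h]
      push_cast at hm
      linarith

lemma mahonianRatio_nonneg (n k ν κ : ℕ) : 0 ≤ mahonianRatio n k ν κ := by
  unfold mahonianRatio; positivity

lemma sum_mahonian_mul_mahonianRatio {n ν κ : ℕ} (h : n ≤ ν) (hκ : κ ≤ ν.choose 2) :
    ∑ k ∈ Finset.range (n.choose 2 + 1), (mahonian n k : ℝ) * mahonianRatio n k ν κ = 1 := by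
  simp only [mahonianRatio, ← mul_div_assoc]
  rw [← Finset.sum_div, sum_mahonian_mul_genMahonian h]
  exact div_self (Nat.cast_ne_zero.2 (mahonian_pos hκ).ne')

lemma mahonianRatio_le_one {n k ν κ : ℕ} (h : n ≤ ν) (hk : k ≤ n.choose 2)
    (hκ : κ ≤ ν.choose 2) : mahonianRatio n k ν κ ≤ 1 := by
  have h1 : (1 : ℝ) ≤ mahonian n k := by exact_mod_cast mahonian_pos hk
  rw [← sum_mahonian_mul_mahonianRatio h hκ]
  refine le_trans (le_mul_of_one_le_left (mahonianRatio_nonneg _ _ _ _) h1) ?_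
  exact Finset.single_le_sum
    (f := fun k => (mahonian n k : ℝ) * mahonianRatio n k ν κ)
    (fun k _ => mul_nonneg (Nat.cast_nonneg _) (mahonianRatio_nonneg _ _ _ _))
    (Finset.mem_range.2 (Nat.lt_succ_of_le hk))

end Counting

lemma qFactorial_pos {q : ℝ} (hq : 0 ≤ q) (n : ℕ) : 0 < qFactorial q n := by
  refine Finset.prod_pos fun j hj => ?_
  have hj1 := (Finset.mem_Icc.1 hj).1
  exact Finset.sum_pos' (fun i _ => pow_nonneg hq i)
    ⟨0, Finset.mem_range.2 hj1, by simp⟩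

lemma qFactorial_inv {q : ℝ} (hq : q ≠ 0) (n : ℕ) :
    qFactorial q n = q ^ n.choose 2 * qFactorial q⁻¹ n := by
  induction n with
  | zero => simp [qFactorial]
  | succ n ih =>
    have hsum : ∑ i ∈ Finset.range (n + 1), q ^ i
        = q ^ n * ∑ i ∈ Finset.range (n + 1), q⁻¹ ^ i := by
      rw [← Finset.sum_range_reflect, Finset.mul_sum]
      refine Finset.sum_congr rfl fun i hi => ?_
      have hi' : i ≤ n := Nat.lt_succ_iff.1 (Finset.mem_range.1 hi)
      rw [show n + 1 - 1 - i = n - i by omega, pow_sub₀ q hq hi', inv_pow]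
    have hstep : ∀ x : ℝ,
        qFactorial x (n + 1) = qFactorial x n * ∑ i ∈ Finset.range (n + 1), x ^ i :=
      fun x => Finset.prod_Icc_succ_top (by omega) _
    rw [hstep, hstep, ih, hsum, Nat.choose_succ_succ' n 1, one_add_one_eq_two,
      Nat.choose_one_right, pow_add]
    ring

lemma mallowsMass_inv {q : ℝ≥0∞} (hq : 1 < q) {n k : ℕ} (hk : k ≤ n.choose 2) :
    mallowsMass q⁻¹ n (n.choose 2 - k) = mallowsMass q n k := by
  have hq0 : q ≠ 0 := (zero_lt_one.trans hq).ne'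
  rw [mallowsMass, mallowsMass, if_neg (ENNReal.inv_ne_top.2 hq0)]
  split_ifs with h1 h2
  · subst h1 h2
    have : qFactorial 0 n = 1 := by
      refine Finset.prod_eq_one fun j hj => ?_
      have hj1 := (Finset.mem_Icc.1 hj).1
      rw [Finset.sum_eq_single_of_mem 0 (Finset.mem_range.2 hj1)]
      · simp
      · intro i _ hi; simp [hi]
    simp [this]
  · have : n.choose 2 - k ≠ 0 := by omega
    subst h1
    simp [this]
  · have hr : q.toReal ≠ 0 := (ENNReal.toReal_pos hq0 h1).ne'
    rw [ENNReal.toReal_inv, qFactorial_inv hr, inv_pow, ← pow_sub_mul_pow q.toReal hk]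
    have := (qFactorial_pos (inv_nonneg.2 (ENNReal.toReal_nonneg (a := q))) n).ne'
    field_simp

lemma mallowsMass_two_zero (q : ℝ≥0∞) :
    mallowsMass q 2 0 = if q = ∞ then 0 else (1 + q.toReal)⁻¹ := by
  have h : qFactorial q.toReal 2 = 1 + q.toReal := by
    rw [qFactorial, Finset.prod_Icc_succ_top (by norm_num)]
    simp [Finset.sum_range_succ]
  rw [mallowsMass, h]
  simp

lemma eq_of_mallowsMass_two_zero_eq {q q' : ℝ≥0∞}
    (h : mallowsMass q 2 0 = mallowsMass q' 2 0) : q = q' := by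
  have hq := ENNReal.toReal_nonneg (a := q)
  have hq' := ENNReal.toReal_nonneg (a := q')
  rw [mallowsMass_two_zero, mallowsMass_two_zero] at h
  split_ifs at h with h1 h2 h2
  · rw [h1, h2]
  · have : 0 < (1 + q'.toReal)⁻¹ := by positivity
    linarith
  · have : 0 < (1 + q.toReal)⁻¹ := by positivity
    linarith
  · exact (ENNReal.toReal_eq_toReal_iff' h1 h2).1 (by linarith [inv_injective h])

/-- If weights `M k` and functions `R k` satisfy `∑ k, M k * R k = 1` and `R (k + 1)` is
asymptotically `q * R k`, then `R k` tends to `q ^ k / ∑ i, M i * q ^ i`. -/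
lemma tendsto_geometric_of_sum_eq_one {ι : Type*} {l : Filter ι} {D : ℕ} {M : ℕ → ℝ}
    {R : ℕ → ι → ℝ} {q : ℝ} (hS : ∑ k ∈ Finset.range (D + 1), M k * q ^ k ≠ 0)
    (hsum : ∀ᶠ ν in l, ∑ k ∈ Finset.range (D + 1), M k * R k ν = 1)
    (hstep : ∀ k < D, Tendsto (fun ν => R (k + 1) ν - q * R k ν) l (𝓝 0)) {k : ℕ} (hk : k ≤ D) :
    Tendsto (R k) l (𝓝 (q ^ k / ∑ i ∈ Finset.range (D + 1), M i * q ^ i)) := by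
  have hdiff : ∀ k ≤ D, Tendsto (fun ν => R k ν - q ^ k * R 0 ν) l (𝓝 0) := by
    intro k
    induction k with
    | zero => intro _; simpa using tendsto_const_nhds
    | succ k ih =>
      intro hk
      have := (hstep k hk).add ((ih (by omega)).const_mul q)
      rw [mul_zero, add_zero] at this
      refine this.congr fun ν => ?_
      ring
  have h0 : Tendsto (R 0) l (𝓝 (∑ i ∈ Finset.range (D + 1), M i * q ^ i)⁻¹) := by
    have h1 : Tendsto (fun ν => ∑ k ∈ Finset.range (D + 1), M k * (R k ν - q ^ k * R 0 ν)) l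
        (𝓝 (∑ k ∈ Finset.range (D + 1), M k * 0)) :=
      tendsto_finsetSum _ fun k hk =>
        (hdiff k (Nat.lt_succ_iff.1 (Finset.mem_range.1 hk))).const_mul _
    have h2 := (h1.const_sub 1).div_const (∑ i ∈ Finset.range (D + 1), M i * q ^ i)
    simp only [mul_zero, Finset.sum_const_zero, sub_zero, one_div] at h2
    refine h2.congr' ?_
    filter_upwards [hsum] with ν hν
    rw [div_eq_iff hS, Finset.mul_sum, ← hν, ← Finset.sum_sub_distrib]
    exact Finset.sum_congr rfl fun k _ => by ring
  have := (hdiff k hk).add (h0.const_mul (q ^ k))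
  rw [zero_add, ← div_eq_mul_inv] at this
  exact this.congr fun ν => by ring

lemma tendsto_const_div_natCast {l : Filter ℕ} (hl : l ≤ atTop) (a : ℝ) :
    Tendsto (fun ν : ℕ => a / (ν : ℝ)) l (𝓝 0) :=
  (tendsto_const_div_atTop_nhds_zero_nat a).mono_left hl

lemma tendsto_mahonianRatio_of_step {l : Filter ℕ} (hl : l ≤ atTop) {κ : ℕ → ℕ}
    (hκ : ∀ᶠ ν in l, κ ν ≤ ν.choose 2) {q : ℝ} (hq : 0 ≤ q) {n : ℕ}
    (hstep : ∀ k < n.choose 2, Tendsto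
      (fun ν => mahonianRatio n (k + 1) ν (κ ν) - q * mahonianRatio n k ν (κ ν)) l (𝓝 0))
    {k : ℕ} (hk : k ≤ n.choose 2) :
    Tendsto (fun ν => mahonianRatio n k ν (κ ν)) l (𝓝 (q ^ k / qFactorial q n)) := by
  rw [← sum_mahonian_mul_pow]
  refine tendsto_geometric_of_sum_eq_one (M := fun k => (mahonian n k : ℝ))
    (R := fun k ν => mahonianRatio n k ν (κ ν)) ?_ ?_ hstep hk
  · rw [sum_mahonian_mul_pow]
    exact (qFactorial_pos hq n).ne'
  · filter_upwards [hκ, hl (eventually_ge_atTop n)] with ν h1 h2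
    exact sum_mahonian_mul_mahonianRatio h2 h1

/-- The lower bound for the quotient of two consecutive ratios. -/
noncomputable def stepBound (n k ν κ : ℕ) : ℝ :=
  ((κ : ℝ) - k) / ((ν : ℝ) - n + (κ - k) - 1)

lemma stepBound_mul_mahonianRatio_le (n k : ℕ) : ∀ᶠ ν in atTop, ∀ κ : ℕ,
    stepBound n k ν κ * mahonianRatio n k ν κ ≤ mahonianRatio n (k + 1) ν κ := by
  filter_upwards [eventually_ge_atTop (n + k + 2)] with ν hν κ
  have hν' : (n : ℝ) + k + 2 ≤ ν := by exact_mod_cast hν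
  have hpos : 0 < (ν : ℝ) - n + (κ - k) - 1 := by
    have : (0 : ℝ) ≤ κ := Nat.cast_nonneg κ
    linarith
  rw [mahonianRatio, mahonianRatio, ← mul_div_assoc]
  refine div_le_div_of_nonneg_right ?_ (Nat.cast_nonneg _)
  rw [stepBound, div_mul_eq_mul_div, div_le_iff₀ hpos, mul_comm (genMahonian n (k + 1) ν κ : ℝ)]
  exact sub_mul_genMahonian_le (by omega) k κ

lemma stepBound_eq {n k ν κ : ℕ} (hν : 0 < ν) :
    stepBound n k ν κ = ((κ : ℝ) / ν - k / ν) /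
      (((κ : ℝ) / ν - k / ν) + (1 - (n + 1) / ν)) := by
  have : (ν : ℝ) ≠ 0 := by positivity
  rw [stepBound, ← mul_div_mul_right _ _ (inv_ne_zero this)]
  congr 1 <;> field_simp
  ring

lemma tendsto_stepBound_of_tendsto {l : Filter ℕ} (hl : l ≤ atTop) {κ : ℕ → ℕ} {t : ℝ}
    (ht : 0 ≤ t) (h : Tendsto (fun ν : ℕ => (κ ν : ℝ) / (ν : ℝ)) l (𝓝 t)) (n k : ℕ) :
    Tendsto (fun ν => stepBound n k ν (κ ν)) l (𝓝 (t / (t + 1))) := by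
  have h1 := h.sub (tendsto_const_div_natCast hl k)
  have h2 := (tendsto_const_div_natCast hl (n + 1 : ℝ)).const_sub 1
  rw [sub_zero] at h1 h2
  refine (h1.div (h1.add h2) (by positivity)).congr' ?_
  filter_upwards [hl (eventually_gt_atTop 0)] with ν hν
  exact (stepBound_eq hν).symm

lemma tendsto_stepBound_of_tendsto_atTop {l : Filter ℕ} (hl : l ≤ atTop) {κ : ℕ → ℕ}
    (h : Tendsto (fun ν : ℕ => (κ ν : ℝ) / (ν : ℝ)) l atTop) (n k : ℕ) :
    Tendsto (fun ν => stepBound n k ν (κ ν)) l (𝓝 1) := by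
  have h1 : Tendsto (fun ν : ℕ => (κ ν : ℝ) / (ν : ℝ) - k / ν) l atTop := by
    simp only [sub_eq_add_neg]
    exact h.atTop_add (tendsto_const_div_natCast hl k).neg
  have h2 := (tendsto_const_div_natCast hl (n + 1 : ℝ)).const_sub 1
  rw [sub_zero] at h2
  have h3 := h1.atTop_add h2
  have h4 := (h2.div_atTop h3).const_sub 1
  rw [sub_zero] at h4
  refine h4.congr' ?_
  filter_upwards [hl (eventually_gt_atTop 0), h3.eventually_gt_atTop 0] with ν hν hpos
  rw [stepBound_eq hν, sub_eq_iff_eq_add, ← add_div, div_self hpos.ne']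

/-- If `θ → q` and `θ * r ≤ s` with `r ∈ [0, 1]`, then `s - q * r` is asymptotically nonnegative. -/
lemma eventually_neg_lt_sub_mul {ι : Type*} {l : Filter ι} {r s θ : ι → ℝ} {q : ℝ}
    (hθ : Tendsto θ l (𝓝 q)) (hr0 : ∀ᶠ ν in l, 0 ≤ r ν) (hr1 : ∀ᶠ ν in l, r ν ≤ 1)
    (h : ∀ᶠ ν in l, θ ν * r ν ≤ s ν) {ε : ℝ} (hε : 0 < ε) :
    ∀ᶠ ν in l, -ε < s ν - q * r ν := by
  filter_upwards [hθ.eventually_const_lt (sub_lt_self q hε), hr0, hr1, h] with ν h1 h2 h3 h4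
  rcases h2.eq_or_lt with h0 | h0
  · rw [← h0] at h4 ⊢
    linarith
  · nlinarith

lemma tendsto_mahonianRatio_of_linear {l : Filter ℕ} (hl : l ≤ atTop) {κ : ℕ → ℕ}
    (hκ : ∀ᶠ ν in l, κ ν ≤ ν.choose 2) {q : ℝ} (hq : 0 ≤ q) (hq1 : q < 1)
    (h : Tendsto (fun ν : ℕ => (κ ν : ℝ) / (ν : ℝ)) l (𝓝 (q / (1 - q)))) {n k : ℕ}
    (hk : k ≤ n.choose 2) :
    Tendsto (fun ν => mahonianRatio n k ν (κ ν)) l (𝓝 (q ^ k / qFactorial q n)) := by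
  refine tendsto_mahonianRatio_of_step hl hκ hq (fun k hk => ?_) hk
  have h1q : 0 < 1 - q := sub_pos.2 hq1
  have hθ := tendsto_stepBound_of_tendsto hl (div_nonneg hq h1q.le) h n k
  rw [show q / (1 - q) / (q / (1 - q) + 1) = q by field_simp; ring] at hθ
  have hr1 : ∀ᶠ ν in l, mahonianRatio n k ν (κ ν) ≤ 1 := by
    filter_upwards [hκ, hl (eventually_ge_atTop n)] with ν h1 h2
    exact mahonianRatio_le_one h2 hk.le h1
  have hr0 : ∀ᶠ ν in l, 0 ≤ mahonianRatio n k ν (κ ν) :=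
    Eventually.of_forall fun ν => mahonianRatio_nonneg _ _ _ _
  have hlow : ∀ᶠ ν in l, stepBound n k ν (κ ν) * mahonianRatio n k ν (κ ν)
      ≤ mahonianRatio n (k + 1) ν (κ ν) :=
    ((stepBound_mul_mahonianRatio_le n k).filter_mono hl).mono fun ν hν => hν _
  rw [Metric.tendsto_nhds]
  intro ε hε
  obtain ⟨ρ, hqρ, hρ⟩ := exists_between (lt_min hq1 (lt_add_of_pos_right q hε))
  have hρ1 := hρ.trans_le (min_le_left _ _)
  have hρε := hρ.trans_le (min_le_right _ _)
  have hρ0 := hq.trans_lt hqρ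
  obtain ⟨c, hc⟩ := genMahonian_succ_le_mul hρ0 hρ1
  have hup : ∀ᶠ ν in l, (κ ν : ℝ) - k ≤ ρ * (ν - n + (κ ν - k) - 1 - c) := by
    have h1 := h.sub (tendsto_const_div_natCast hl k)
    have h2 := (((tendsto_const_div_natCast hl (n + 1 + c : ℝ)).const_sub 1).add h1).const_mul ρ
    have hlt : q / (1 - q) - 0 < ρ * (1 - 0 + (q / (1 - q) - 0)) := by
      have : ρ * (1 - 0 + (q / (1 - q) - 0)) = ρ / (1 - q) := by field_simp; ring
      rw [this, sub_zero]
      exact div_lt_div_of_pos_right hqρ h1q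
    filter_upwards [h1.eventually_lt h2 hlt, hl (eventually_gt_atTop 0)] with ν h3 hν
    have hν' : (0 : ℝ) < ν := by exact_mod_cast hν
    have h4 := (mul_lt_mul_of_pos_right h3 hν').le
    have e1 : ((κ ν : ℝ) / ν - k / ν) * ν = κ ν - k := by field_simp
    have e2 : ρ * (1 - (n + 1 + c) / ν + ((κ ν : ℝ) / ν - k / ν)) * ν
        = ρ * (ν - n + (κ ν - k) - 1 - c) := by field_simp; ring
    rwa [e1, e2] at h4
  filter_upwards [eventually_neg_lt_sub_mul hθ hr0 hr1 hlow hε, hup, hr0, hr1,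
    hl (eventually_ge_atTop n)] with ν h1 h2 h3 h4 h5
  have h6 : mahonianRatio n (k + 1) ν (κ ν) ≤ ρ * mahonianRatio n k ν (κ ν) := by
    rw [mahonianRatio, mahonianRatio, ← mul_div_assoc]
    exact div_le_div_of_nonneg_right (hc n ν k (κ ν) h5 h2) (Nat.cast_nonneg _)
  rw [Real.dist_eq, sub_zero, abs_lt]
  exact ⟨h1, by nlinarith⟩

lemma tendsto_mahonianRatio_of_superlinear {l : Filter ℕ} (hl : l ≤ atTop) {κ : ℕ → ℕ}
    (hκ : ∀ᶠ ν in l, κ ν ≤ ν.choose 2)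
    (h : Tendsto (fun ν : ℕ => (κ ν : ℝ) / (ν : ℝ)) l atTop)
    (h' : Tendsto (fun ν : ℕ => ((ν.choose 2 - κ ν : ℕ) : ℝ) / (ν : ℝ)) l atTop) {n k : ℕ}
    (hk : k ≤ n.choose 2) :
    Tendsto (fun ν => mahonianRatio n k ν (κ ν)) l (𝓝 (1 ^ k / qFactorial 1 n)) := by
  refine tendsto_mahonianRatio_of_step hl hκ zero_le_one (fun k hk => ?_) hk
  have hr0 : ∀ k, ∀ᶠ ν in l, 0 ≤ mahonianRatio n k ν (κ ν) :=
    fun k => Eventually.of_forall fun ν => mahonianRatio_nonneg _ _ _ _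
  have hr1 : ∀ k ≤ n.choose 2, ∀ᶠ ν in l, mahonianRatio n k ν (κ ν) ≤ 1 := by
    intro k hk
    filter_upwards [hκ, hl (eventually_ge_atTop n)] with ν h1 h2
    exact mahonianRatio_le_one h2 hk h1
  have hlow : ∀ᶠ ν in l, stepBound n k ν (κ ν) * mahonianRatio n k ν (κ ν)
      ≤ mahonianRatio n (k + 1) ν (κ ν) :=
    ((stepBound_mul_mahonianRatio_le n k).filter_mono hl).mono fun ν hν => hν _
  have hup : ∀ᶠ ν in l, stepBound n (n.choose 2 - (k + 1)) ν (ν.choose 2 - κ ν)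
      * mahonianRatio n (k + 1) ν (κ ν) ≤ mahonianRatio n k ν (κ ν) := by
    filter_upwards [hl (stepBound_mul_mahonianRatio_le n (n.choose 2 - (k + 1))), hκ,
      hl (eventually_ge_atTop n)] with ν h1 h2 h3
    have h4 := h1 (ν.choose 2 - κ ν)
    rwa [show n.choose 2 - (k + 1) + 1 = n.choose 2 - k by omega,
      mahonianRatio_reflect h3 hk h2, mahonianRatio_reflect h3 hk.le h2] at h4
  rw [Metric.tendsto_nhds]
  intro ε hε
  filter_upwards [eventually_neg_lt_sub_mul (tendsto_stepBound_of_tendsto_atTop hl h n k)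
      (hr0 k) (hr1 k hk.le) hlow hε,
    eventually_neg_lt_sub_mul (tendsto_stepBound_of_tendsto_atTop hl h' n (n.choose 2 - (k + 1)))
      (hr0 (k + 1)) (hr1 (k + 1) hk) hup hε] with ν h1 h2
  rw [Real.dist_eq, sub_zero, abs_lt]
  constructor <;> linarith

/-- The regime of parameter `q ∈ [0, ∞]`, along a filter `l`. -/
def MahonianRegime (l : Filter ℕ) (κ : ℕ → ℕ) (q : ℝ≥0∞) : Prop :=
  (q < 1 ∧ Tendsto (fun ν : ℕ => (κ ν : ℝ) / (ν : ℝ)) l (𝓝 (q.toReal / (1 - q.toReal)))) ∨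
  (1 < q ∧ Tendsto (fun ν : ℕ => ((ν.choose 2 : ℝ) - (κ ν : ℝ)) / (ν : ℝ)) l
    (𝓝 ((q⁻¹).toReal / (1 - (q⁻¹).toReal)))) ∨
  (q = 1 ∧ Tendsto (fun ν : ℕ => (κ ν : ℝ) / (ν : ℝ)) l atTop ∧
    Tendsto (fun ν : ℕ => ((ν.choose 2 : ℝ) - (κ ν : ℝ)) / (ν : ℝ)) l atTop)

theorem MahonianRegime.tendsto_mahonianRatio {l : Filter ℕ} (hl : l ≤ atTop) {κ : ℕ → ℕ}
    (hκ : ∀ᶠ ν in l, κ ν ≤ ν.choose 2) {q : ℝ≥0∞} (h : MahonianRegime l κ q) {n k : ℕ}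
    (hk : k ≤ n.choose 2) :
    Tendsto (fun ν => mahonianRatio n k ν (κ ν)) l (𝓝 (mallowsMass q n k)) := by
  have hlow : ∀ {κ : ℕ → ℕ} {q : ℝ≥0∞} {k : ℕ}, (∀ᶠ ν in l, κ ν ≤ ν.choose 2) → q < 1 →
      Tendsto (fun ν : ℕ => (κ ν : ℝ) / (ν : ℝ)) l (𝓝 (q.toReal / (1 - q.toReal))) →
      k ≤ n.choose 2 →
      Tendsto (fun ν => mahonianRatio n k ν (κ ν)) l (𝓝 (mallowsMass q n k)) := by
    intro κ q k hκ hq h hk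
    rw [mallowsMass, if_neg hq.ne_top]
    refine tendsto_mahonianRatio_of_linear hl hκ ENNReal.toReal_nonneg ?_ h hk
    rw [← ENNReal.toReal_one]
    exact (ENNReal.toReal_lt_toReal hq.ne_top ENNReal.one_ne_top).2 hq
  have hsub : (fun ν : ℕ => ((ν.choose 2 : ℝ) - (κ ν : ℝ)) / (ν : ℝ))
      =ᶠ[l] fun ν => ((ν.choose 2 - κ ν : ℕ) : ℝ) / (ν : ℝ) := by
    filter_upwards [hκ] with ν hν
    rw [Nat.cast_sub hν]
  rcases h with ⟨hq, h⟩ | ⟨hq, h⟩ | ⟨rfl, h, h'⟩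
  · exact hlow hκ hq h hk
  · rw [← mallowsMass_inv hq hk]
    refine (hlow (κ := fun ν => ν.choose 2 - κ ν) (k := n.choose 2 - k)
      (Eventually.of_forall fun ν => Nat.sub_le _ _) (ENNReal.inv_lt_one.2 hq)
      (h.congr' hsub) (Nat.sub_le _ _)).congr' ?_
    filter_upwards [hκ, hl (eventually_ge_atTop n)] with ν h1 h2
    exact mahonianRatio_reflect h2 hk h1
  · have := tendsto_mahonianRatio_of_superlinear hl hκ h (h'.congr' hsub) hk
    simpa [mallowsMass] using this

lemma Ultrafilter.exists_tendsto_or_tendsto_atTop {ι : Type*} (g : Ultrafilter ι) {u : ι → ℝ}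
    (hu : ∀ᶠ ν in (g : Filter ι), 0 ≤ u ν) :
    (∃ t, 0 ≤ t ∧ Tendsto u g (𝓝 t)) ∨ Tendsto u g atTop := by
  have hlim : Tendsto (fun ν => ENNReal.ofReal (u ν)) g
      (𝓝 (g.map fun ν => ENNReal.ofReal (u ν)).lim) :=
    (g.map fun ν => ENNReal.ofReal (u ν)).le_nhds_lim
  set t := (g.map fun ν => ENNReal.ofReal (u ν)).lim
  by_cases ht : t = ∞
  · right
    rw [ht] at hlim
    exact ENNReal.tendsto_ofReal_nhds_top.1 hlim
  · left
    refine ⟨t.toReal, ENNReal.toReal_nonneg, ((ENNReal.tendsto_toReal ht).comp hlim).congr' ?_⟩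
    filter_upwards [hu] with ν hν
    exact ENNReal.toReal_ofReal hν

lemma exists_lt_one_div_one_sub_eq {t : ℝ} (ht : 0 ≤ t) :
    ∃ q : ℝ≥0∞, q < 1 ∧ q.toReal / (1 - q.toReal) = t := by
  have h1 : 0 < 1 + t := by positivity
  refine ⟨ENNReal.ofReal (t / (1 + t)), ?_, ?_⟩
  · rw [ENNReal.ofReal_lt_one, div_lt_one h1]
    linarith
  · rw [ENNReal.toReal_ofReal (by positivity)]
    field_simp
    ring

lemma Ultrafilter.exists_mahonianRegime (g : Ultrafilter ℕ) {κ : ℕ → ℕ}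
    (hκ : ∀ᶠ ν in (g : Filter ℕ), κ ν ≤ ν.choose 2) :
    ∃ q, MahonianRegime g κ q := by
  rcases g.exists_tendsto_or_tendsto_atTop (u := fun ν : ℕ => (κ ν : ℝ) / (ν : ℝ))
    (Eventually.of_forall fun ν => by positivity) with ⟨t, ht, h⟩ | h
  · obtain ⟨q, hq, rfl⟩ := exists_lt_one_div_one_sub_eq ht
    exact ⟨q, Or.inl ⟨hq, h⟩⟩
  rcases g.exists_tendsto_or_tendsto_atTop
    (u := fun ν : ℕ => ((ν.choose 2 : ℝ) - (κ ν : ℝ)) / (ν : ℝ)) (by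
      filter_upwards [hκ] with ν hν
      exact div_nonneg (sub_nonneg.2 (Nat.cast_le.2 hν)) (Nat.cast_nonneg _)) with ⟨t, ht, h'⟩ | h'
  · obtain ⟨q, hq, rfl⟩ := exists_lt_one_div_one_sub_eq ht
    refine ⟨q⁻¹, Or.inr (Or.inl ⟨ENNReal.one_lt_inv.2 hq, ?_⟩)⟩
    rwa [inv_inv]
  · exact ⟨1, Or.inr (Or.inr ⟨rfl, h, h'⟩)⟩

lemma MahonianRegime.of_ultrafilter {l : Filter ℕ} {κ : ℕ → ℕ} {q : ℝ≥0∞}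
    (h : ∀ g : Ultrafilter ℕ, ↑g ≤ l → MahonianRegime g κ q) : MahonianRegime l κ q := by
  rcases lt_trichotomy q 1 with hq | rfl | hq
  · refine Or.inl ⟨hq, tendsto_iff_ultrafilter _ _ _ |>.2 fun g hg => ?_⟩
    rcases h g hg with h | h | h
    exacts [h.2, absurd h.1 hq.not_gt, absurd h.1 hq.ne]
  · have h' : ∀ g : Ultrafilter ℕ, ↑g ≤ l →
        Tendsto (fun ν : ℕ => (κ ν : ℝ) / (ν : ℝ)) g atTop ∧
        Tendsto (fun ν : ℕ => ((ν.choose 2 : ℝ) - (κ ν : ℝ)) / (ν : ℝ)) g atTop := by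
      intro g hg
      rcases h g hg with h | h | h
      exacts [absurd h.1 (lt_irrefl _), absurd h.1 (lt_irrefl _), h.2]
    exact Or.inr (Or.inr ⟨rfl, tendsto_iff_ultrafilter _ _ _ |>.2 fun g hg => (h' g hg).1,
      tendsto_iff_ultrafilter _ _ _ |>.2 fun g hg => (h' g hg).2⟩)
  · refine Or.inr (Or.inl ⟨hq, tendsto_iff_ultrafilter _ _ _ |>.2 fun g hg => ?_⟩)
    rcases h g hg with h | h | h
    exacts [absurd h.1 hq.not_gt, h.2, absurd h.1 hq.ne']

theorem RatiosTendTo.exists_mahonianRegime {κ : ℕ → ℕ}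
    (hκ : ∀ᶠ ν : ℕ in atTop, κ ν ≤ ν.choose 2) {L : ℕ → ℕ → ℝ} (hL : RatiosTendTo κ L) :
    ∃ q, MahonianRegime atTop κ q := by
  have hval : ∀ (g : Ultrafilter ℕ) (q : ℝ≥0∞), ↑g ≤ (atTop : Filter ℕ) → MahonianRegime g κ q →
      L 2 0 = mallowsMass q 2 0 := fun g q hg h =>
    tendsto_nhds_unique ((hL 2 0 (by norm_num) (Nat.zero_le _)).mono_left hg)
      (h.tendsto_mahonianRatio hg (hg hκ) (Nat.zero_le _))
  obtain ⟨q, hq⟩ := (Ultrafilter.of (atTop : Filter ℕ)).exists_mahonianRegime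
    (Ultrafilter.of_le _ hκ)
  refine ⟨q, MahonianRegime.of_ultrafilter fun g hg => ?_⟩
  obtain ⟨q', hq'⟩ := g.exists_mahonianRegime (hg hκ)
  have : q = q' := eq_of_mallowsMass_two_zero_eq
    ((hval _ q (Ultrafilter.of_le _) hq).symm.trans (hval g q' hg hq'))
  rwa [this]

theorem corollary1 (κ : ℕ → ℕ) (hκ : ∀ᶠ ν : ℕ in atTop, κ ν ≤ ν.choose 2) :
    -- if all the ratios converge, the limit is `q^k / [n]_q!` for some `q ∈ [0, ∞]`
    (∀ L : ℕ → ℕ → ℝ, RatiosTendTo κ L →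
      ∃ q : ℝ≥0∞, ∀ n k : ℕ, 1 ≤ n → k ≤ n.choose 2 → L n k = mallowsMass q n k) ∧
    -- the ratios all converge if and only if `κ` is in one of the three regimes
    ((∃ L : ℕ → ℕ → ℝ, RatiosTendTo κ L) ↔
      (∃ q : ℝ≥0∞, q < 1 ∧ LowRegime κ q) ∨ (∃ q : ℝ≥0∞, 1 < q ∧ HighRegime κ q) ∨
        SuperlinearRegime κ) ∧
    -- and the parameter `q` of the limit is the one of the regime
    (∀ q : ℝ≥0∞, RatiosTendTo κ (mallowsMass q) ↔
      (q < 1 ∧ LowRegime κ q) ∨ (1 < q ∧ HighRegime κ q) ∨ (q = 1 ∧ SuperlinearRegime κ)) := by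
  have hconv : ∀ q, MahonianRegime atTop κ q → RatiosTendTo κ (mallowsMass q) :=
    fun q h n k _ hk => h.tendsto_mahonianRatio le_rfl hκ hk
  have huniq : ∀ {L L' : ℕ → ℕ → ℝ}, RatiosTendTo κ L → RatiosTendTo κ L' →
      ∀ n k : ℕ, 1 ≤ n → k ≤ n.choose 2 → L n k = L' n k :=
    fun h h' n k hn hk => tendsto_nhds_unique (h n k hn hk) (h' n k hn hk)
  refine ⟨fun L hL => ?_, ⟨?_, ?_⟩, fun q => ⟨fun h => ?_, hconv q⟩⟩
  · obtain ⟨q, hq⟩ := hL.exists_mahonianRegime hκ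
    exact ⟨q, huniq hL (hconv q hq)⟩
  · rintro ⟨L, hL⟩
    obtain ⟨q, h | h | h⟩ := hL.exists_mahonianRegime hκ
    exacts [Or.inl ⟨q, h⟩, Or.inr (Or.inl ⟨q, h⟩), Or.inr (Or.inr h.2)]
  · rintro (⟨q, h⟩ | ⟨q, h⟩ | h)
    exacts [⟨_, hconv q (Or.inl h)⟩, ⟨_, hconv q (Or.inr (Or.inl h))⟩,
      ⟨_, hconv 1 (Or.inr (Or.inr ⟨rfl, h⟩))⟩]
  · obtain ⟨q', hq'⟩ := h.exists_mahonianRegime hκ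
    rwa [eq_of_mallowsMass_two_zero_eq
      (huniq h (hconv q' hq') 2 0 (by norm_num) (Nat.zero_le _))]
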